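/- Let $S=[-\tfrac12,\tfrac12]^2$ be the unit square with Euclidean distance $d$, let $0<\alpha<2$ and $0<\epsilon_1\le\epsilon_2<\infty$, and let $\epsilon>\frac{(2-\alpha)(1+\alpha)}{2+\alpha}$. There is a constant $D_1=D_1(\epsilon,\alpha,\epsilon_1,\epsilon_2)>0$ such that the following holds for all $c_1,c_2>0$. Let $f$ be a probability density on $S$ with $\epsilon_1\le f(x)\le\epsilon_2$ for all $x\in S$, let $h:S\times S\to[0,\infty)$ be measurable with $$c_1\,d(x,y)\le h(x,y)=h(y,x)\le c_2\,d(x,y)\qquad\text{for all }x,y\in S,$$ and let $X_1,X_2,\ldots$ be independent random points of $S$, each with density $f$. Let $K_n$ be the complete graph on the nodes $X_1,\ldots,X_n$, give the edge $(X_i,X_j)$ the weight $h(X_i,X_j)^{\alpha}$, and let $TSP_n$ be the minimum, over all spanning cycles of $K_n$, of the sum of the weights of the edges of the cycle. Then $TSP_n$ is square integrable and $$\mathrm{var}(TSP_n)\le D_1\,n^{\epsilon}$$ for all $n\ge n_0$, where $n_0$ depends only on $\epsilon,\alpha,\epsilon_1,\epsilon_2,c_1,c_2$. -/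

import Mathlib

open MeasureTheory ProbabilityTheory

/-- The unit square `[-1/2, 1/2]²` of the Euclidean plane. As a type it carries the Euclidean
distance `dist`. -/
def unitSquare : Set (EuclideanSpace ℝ (Fin 2)) :=
  {x | ∀ i, x i ∈ Set.Icc (-(1 / 2) : ℝ) (1 / 2)}

/-- The weight `∑ h(e) ^ α` of the spanning cycle `(x (σ 0), x (σ 1), …, x (σ (n - 1)), x (σ 0))`
through the nodes `x 0, …, x (n - 1)`; here `finRotate n` is the cyclic successor `i ↦ i + 1`
on `Fin n`. (For `n ≥ 3` the `n` edges that are summed are pairwise different.) -/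
noncomputable def cycleWeight {V : Type*} (h : V → V → ℝ) (α : ℝ) {n : ℕ} (x : Fin n → V)
    (σ : Equiv.Perm (Fin n)) : ℝ :=
  ∑ i : Fin n, h (x (σ i)) (x (σ (finRotate n i))) ^ α

/-- The minimum weight of a spanning cycle of the complete graph on the nodes
`x 0, …, x (n - 1)`. -/
noncomputable def tspWeight {V : Type*} (h : V → V → ℝ) (α : ℝ) {n : ℕ} (x : Fin n → V) : ℝ :=
  (Finset.univ : Finset (Equiv.Perm (Fin n))).inf' Finset.univ_nonempty (cycleWeight h α x)

/-- The random variable `TSP_n`: the minimum weight of a spanning cycle through the first `n`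
nodes `X 0, …, X (n - 1)` of a random sequence of nodes. -/
noncomputable def TSP {Ω V : Type*} (h : V → V → ℝ) (α : ℝ) (X : ℕ → Ω → V) (n : ℕ) (ω : Ω) : ℝ :=
  tspWeight h α (fun i : Fin n => X i ω)

/-! The argument yields every exponent above 1 - α/2. This is enough, since (2-α)(1+α)/(2+α) - (1 -
α/2) = α(2-α)/(2(2+α)) ≥ 0.

By Efron–Stein (`variance_le_sum_integral_update`) the variance is at most the sum over i of the
expected squared increase of the minimum when node i moves to a fresh random point y. Since only
increases count, it suffices to repair one optimal tour: cut i out and reinsert it in front of a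
node j lying in the grid cell of y (`tspWeight_update_le`). The increase is at most a constant times
d(y, x_j)^α plus the α-th powers of the lengths of the tour edges at i and of the edge entering j.
These are bounded, so the square is at most linear in them.

Let A be the sum of d^α over the optimal tour, on an m × m grid whose cells have probability at most
q. Averaging over y and summing over i gives a multiple of n m^(-α) + (1 + nq) A
(`sum_integral_update_le`). Comparison with a snake-shaped tour gives A = O(n m^(-α) + 1)
(`tspWeight_le_of_cells_nonempty`).

For m about n^(1/2 - δ) a cell holds about n^(2δ) nodes, so the bound is n^(1 - α/2 + O(δ)). Grids
with a cell that is empty, or emptied by removing one node, are exponentially rare in a power of n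
(`measure_exists_cell_avoided_le`), which beats the crude polynomial bound used there. -/

/-! ### The Efron–Stein inequality, by swapping independent copies -/

section EfronStein

variable {ι V : Type*} [DecidableEq ι]

/-- The first components of a family of pairs, those with index in `S` replaced by the second
component. -/
def mixOn (S : Finset ι) (z : ι → V × V) : ι → V := fun k => if k ∈ S then (z k).2 else (z k).1

/-- Swap the two components of the pairs whose index is in `S`. -/
def swapOn (S : Finset ι) (z : ι → V × V) : ι → V × V := fun k => if k ∈ S then (z k).swap else z k

/-- The hypothesis says that `U` is the symmetric difference of `S` and `T`: two exchanges at the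
same index cancel. -/
theorem mixOn_swapOn (S T U : Finset ι) (h : ∀ k, k ∈ U ↔ (k ∈ T ↔ k ∉ S)) (z : ι → V × V) :
    mixOn T (swapOn S z) = mixOn U z := by
  funext k
  have := h k
  unfold mixOn swapOn
  by_cases h1 : k ∈ S <;> by_cases h2 : k ∈ T <;> simp_all

variable [MeasurableSpace V]

theorem measurable_mixOn (S : Finset ι) : Measurable (mixOn S : (ι → V × V) → ι → V) := by
  refine measurable_pi_iff.2 fun k => ?_
  unfold mixOn
  split_ifs <;> fun_prop

variable [Fintype ι]

theorem measurePreserving_swapOn (S : Finset ι) (μ : Measure V) [IsProbabilityMeasure μ] :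
    MeasurePreserving (swapOn S : (ι → V × V) → ι → V × V)
      (Measure.pi fun _ => μ.prod μ) (Measure.pi fun _ => μ.prod μ) := by
  refine measurePreserving_pi (fun _ => μ.prod μ) (fun _ => μ.prod μ)
    (f := fun k p => if k ∈ S then p.swap else p) fun k => ?_
  by_cases h : k ∈ S
  · simpa [h] using (Measure.measurePreserving_swap (μ := μ) (ν := μ))
  · simp only [h, if_false]
    exact MeasurePreserving.id (μ.prod μ)

theorem integral_swapOn (S : Finset ι) (μ : Measure V) [IsProbabilityMeasure μ]
    {g : (ι → V × V) → ℝ} (hg : Measurable g) :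
    ∫ z, g (swapOn S z) ∂(Measure.pi fun _ => μ.prod μ) =
      ∫ z, g z ∂(Measure.pi fun _ => μ.prod μ) := by
  have h := measurePreserving_swapOn S μ
  conv_rhs => rw [← h.map_eq]
  rw [integral_map h.measurable.aemeasurable hg.aestronglyMeasurable]

/-- Telescoping over the indices of `S`. Swapping pair k rewrites the k-th increment with the
opposite sign, so twice the increment is the integral of a product of two differences. By ab ≤ (a² +
b²)/2 this is at most half the sum of two integrated squares, which are equal after a swap on the
earlier indices. -/
theorem integral_mul_sub_mixOn_le (μ : Measure V) [IsProbabilityMeasure μ]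
    {f : (ι → V) → ℝ} (hf : Measurable f) {M : ℝ} (hM : ∀ x, |f x| ≤ M) (S : Finset ι) :
    ∫ z, f (mixOn ∅ z) * (f (mixOn ∅ z) - f (mixOn S z)) ∂(Measure.pi fun _ => μ.prod μ) ≤
      ∑ k ∈ S, (1 / 2) * ∫ z, (f (mixOn {k} z) - f (mixOn ∅ z)) ^ 2
        ∂(Measure.pi fun _ => μ.prod μ) := by
  have hm : ∀ T : Finset ι, Measurable fun z : ι → V × V => f (mixOn T z) :=
    fun T => hf.comp (measurable_mixOn T)
  have hint : ∀ g : (ι → V × V) → ℝ, Measurable g → (∃ C, ∀ z, |g z| ≤ C) →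
      Integrable g (Measure.pi fun _ => μ.prod μ) := by
    rintro g hg ⟨C, hC⟩
    exact Integrable.of_bound hg.aestronglyMeasurable C (.of_forall hC)
  have hd : ∀ T U z, |f (mixOn T z) - f (mixOn U z)| ≤ 2 * M := fun T U z => by
    have h1 := abs_le.1 (hM (mixOn T z))
    have h2 := abs_le.1 (hM (mixOn U z))
    rw [abs_le]; constructor <;> linarith
  have hp : ∀ A T U, Integrable (fun z : ι → V × V =>
      f (mixOn A z) * (f (mixOn T z) - f (mixOn U z))) (Measure.pi fun _ => μ.prod μ) := by
    intro A T U
    refine hint _ ((hm A).mul ((hm T).sub (hm U))) ⟨M * (2 * M), fun z => ?_⟩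
    rw [abs_mul]
    exact mul_le_mul (hM _) (hd _ _ _) (abs_nonneg _) ((abs_nonneg _).trans (hM (mixOn A z)))
  have hs : ∀ T U, Integrable (fun z : ι → V × V =>
      (f (mixOn T z) - f (mixOn U z)) ^ 2) (Measure.pi fun _ => μ.prod μ) := by
    intro T U
    refine hint _ (((hm T).sub (hm U)).pow_const 2) ⟨(2 * M) ^ 2, fun z => ?_⟩
    rw [abs_pow]
    exact pow_le_pow_left₀ (abs_nonneg _) (hd _ _ _) 2
  induction S using Finset.induction_on with
  | empty => simp
  | insert k S hk ih =>
    rw [Finset.sum_insert hk]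
    have e1 : ∫ z, f (mixOn ∅ z) * (f (mixOn ∅ z) - f (mixOn (insert k S) z))
          ∂(Measure.pi fun _ => μ.prod μ) =
        ∫ z, f (mixOn ∅ z) * (f (mixOn ∅ z) - f (mixOn S z)) ∂(Measure.pi fun _ => μ.prod μ) +
        ∫ z, f (mixOn ∅ z) * (f (mixOn S z) - f (mixOn (insert k S) z))
          ∂(Measure.pi fun _ => μ.prod μ) := by
      rw [← integral_add (hp _ _ _) (hp _ _ _)]
      congr 1; funext z; ring
    have e2 : ∫ z, f (mixOn ∅ z) * (f (mixOn S z) - f (mixOn (insert k S) z))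
          ∂(Measure.pi fun _ => μ.prod μ) =
        ∫ z, f (mixOn {k} z) * (f (mixOn (insert k S) z) - f (mixOn S z))
          ∂(Measure.pi fun _ => μ.prod μ) := by
      rw [← integral_swapOn {k} μ
        (g := fun z => f (mixOn ∅ z) * (f (mixOn S z) - f (mixOn (insert k S) z)))
        ((hm ∅).mul ((hm S).sub (hm (insert k S))))]
      congr 1; funext z
      rw [mixOn_swapOn {k} ∅ {k}, mixOn_swapOn {k} S (insert k S),
        mixOn_swapOn {k} (insert k S) S]
      all_goals
        intro l
        by_cases hl : l = k
        · subst hl; simp [hk]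
        · simp [hl]
    have e3 : ∫ z, (f (mixOn (insert k S) z) - f (mixOn S z)) ^ 2
          ∂(Measure.pi fun _ => μ.prod μ) =
        ∫ z, (f (mixOn {k} z) - f (mixOn ∅ z)) ^ 2 ∂(Measure.pi fun _ => μ.prod μ) := by
      rw [← integral_swapOn S μ (g := fun z => (f (mixOn {k} z) - f (mixOn ∅ z)) ^ 2)
        (((hm {k}).sub (hm ∅)).pow_const 2)]
      congr 1; funext z
      rw [mixOn_swapOn S {k} (insert k S), mixOn_swapOn S ∅ S]
      all_goals
        intro l
        by_cases hl : l = k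
        · subst hl; simp [hk]
        · simp [hl]
    have e4 : ∫ z, f (mixOn ∅ z) * (f (mixOn S z) - f (mixOn (insert k S) z))
          ∂(Measure.pi fun _ => μ.prod μ) +
        ∫ z, f (mixOn {k} z) * (f (mixOn (insert k S) z) - f (mixOn S z))
          ∂(Measure.pi fun _ => μ.prod μ) ≤
        (1 / 2) * ∫ z, (f (mixOn (insert k S) z) - f (mixOn S z)) ^ 2
          ∂(Measure.pi fun _ => μ.prod μ) +
        (1 / 2) * ∫ z, (f (mixOn {k} z) - f (mixOn ∅ z)) ^ 2 ∂(Measure.pi fun _ => μ.prod μ) := by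
      rw [← integral_const_mul, ← integral_const_mul, ← integral_add (hp _ _ _) (hp _ _ _),
        ← integral_add ((hs _ _).const_mul _) ((hs _ _).const_mul _)]
      refine integral_mono ((hp _ _ _).add (hp _ _ _))
        (((hs _ _).const_mul _).add ((hs _ _).const_mul _)) fun z => ?_
      simp only
      nlinarith [sq_nonneg (f (mixOn (insert k S) z) - f (mixOn S z)
        - (f (mixOn {k} z) - f (mixOn ∅ z)))]
    linarith

/-- A square is the sum of the squares of the positive and negative parts; swapping pair k exchanges
the two, which absorbs the factor 1/2. -/
theorem integral_sq_sub_mixOn_singleton (μ : Measure V) [IsProbabilityMeasure μ]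
    {f : (ι → V) → ℝ} (hf : Measurable f) {M : ℝ} (hM : ∀ x, |f x| ≤ M) (k : ι) :
    (1 / 2) * ∫ z, (f (mixOn {k} z) - f (mixOn ∅ z)) ^ 2 ∂(Measure.pi fun _ => μ.prod μ) =
      ∫ x, ∫ y, (max (f (Function.update x k y) - f x) 0) ^ 2 ∂μ ∂(Measure.pi fun _ => μ) := by
  have hm : ∀ T : Finset ι, Measurable fun z : ι → V × V => f (mixOn T z) :=
    fun T => hf.comp (measurable_mixOn T)
  have hmax : ∀ T U : Finset ι, Measurable fun z : ι → V × V =>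
      (max (f (mixOn T z) - f (mixOn U z)) 0) ^ 2 :=
    fun T U => (((hm T).sub (hm U)).max measurable_const).pow_const 2
  have hb : ∀ a b : ℝ, |a| ≤ M → |b| ≤ M → |(max (a - b) 0) ^ 2| ≤ (2 * M) ^ 2 := by
    intro a b ha hb
    rw [abs_pow]
    refine pow_le_pow_left₀ (abs_nonneg _) ?_ 2
    rw [abs_of_nonneg (le_max_right _ _)]
    have := abs_le.1 ha
    have := abs_le.1 hb
    exact max_le (by linarith) (by linarith)
  have hint : ∀ T U, Integrable (fun z : ι → V × V =>
      (max (f (mixOn T z) - f (mixOn U z)) 0) ^ 2) (Measure.pi fun _ => μ.prod μ) :=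
    fun T U => Integrable.of_bound (hmax T U).aestronglyMeasurable _
      (.of_forall fun z => hb _ _ (hM _) (hM _))
  have e1 : ∫ z, (f (mixOn {k} z) - f (mixOn ∅ z)) ^ 2 ∂(Measure.pi fun _ => μ.prod μ) =
      ∫ z, (max (f (mixOn {k} z) - f (mixOn ∅ z)) 0) ^ 2 ∂(Measure.pi fun _ => μ.prod μ) +
      ∫ z, (max (f (mixOn ∅ z) - f (mixOn {k} z)) 0) ^ 2 ∂(Measure.pi fun _ => μ.prod μ) := by
    rw [← integral_add (hint _ _) (hint _ _)]
    congr 1; funext z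
    rcases le_total (f (mixOn {k} z)) (f (mixOn ∅ z)) with h | h
    · rw [max_eq_right (by linarith), max_eq_left (by linarith)]; ring
    · rw [max_eq_left (by linarith), max_eq_right (by linarith)]; ring
  have e2 : ∫ z, (max (f (mixOn ∅ z) - f (mixOn {k} z)) 0) ^ 2 ∂(Measure.pi fun _ => μ.prod μ) =
      ∫ z, (max (f (mixOn {k} z) - f (mixOn ∅ z)) 0) ^ 2 ∂(Measure.pi fun _ => μ.prod μ) := by
    rw [← integral_swapOn {k} μ (hmax _ _)]
    congr 1; funext z
    rw [mixOn_swapOn {k} ∅ {k} (by simp), mixOn_swapOn {k} {k} ∅ (by simp)]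
  have hmp : MeasurePreserving (fun z : ι → V × V => ((fun i => (z i).1), (z k).2))
      (Measure.pi fun _ => μ.prod μ) ((Measure.pi fun _ => μ).prod μ) :=
    ((MeasurePreserving.id _).prod (measurePreserving_eval (fun _ : ι => μ) k)).comp
      (measurePreserving_arrowProdEquivProdArrow V V ι (fun _ => μ) (fun _ => μ))
  have hu : Measurable fun p : (ι → V) × V => (max (f (Function.update p.1 k p.2) - f p.1) 0) ^ 2 := by
    refine (((hf.comp ?_).sub (hf.comp measurable_fst)).max measurable_const).pow_const 2
    exact measurable_update'
  have e3 : ∫ z, (max (f (mixOn {k} z) - f (mixOn ∅ z)) 0) ^ 2 ∂(Measure.pi fun _ => μ.prod μ) =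
      ∫ p, (max (f (Function.update p.1 k p.2) - f p.1) 0) ^ 2
        ∂((Measure.pi fun _ => μ).prod μ) := by
    rw [← hmp.map_eq, integral_map hmp.measurable.aemeasurable hu.aestronglyMeasurable]
    congr 1; funext z
    have h1 : mixOn {k} z = Function.update (fun i => (z i).1) k (z k).2 := by
      funext i
      by_cases h : i = k
      · subst h; simp [mixOn]
      · simp [mixOn, h]
    have h2 : mixOn ∅ z = fun i => (z i).1 := by funext i; simp [mixOn]
    rw [h1, h2]
  rw [e1, e2, e3, integral_prod _ (Integrable.of_bound hu.aestronglyMeasurable _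
    (.of_forall fun z => hb _ _ (hM _) (hM _)))]
  ring

/-- The one-sided **Efron–Stein inequality**. -/
theorem variance_le_sum_integral_update (μ : Measure V) [IsProbabilityMeasure μ]
    {f : (ι → V) → ℝ} (hf : Measurable f) {M : ℝ} (hM : ∀ x, |f x| ≤ M) :
    variance f (Measure.pi fun _ => μ) ≤
      ∑ k, ∫ x, ∫ y, (max (f (Function.update x k y) - f x) 0) ^ 2 ∂μ
        ∂(Measure.pi fun _ => μ) := by
  have hL : MemLp f 2 (Measure.pi fun _ : ι => μ) :=
    MemLp.of_bound hf.aestronglyMeasurable M (.of_forall hM)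
  have hi : Integrable f (Measure.pi fun _ : ι => μ) := hL.integrable (by norm_num)
  have hi2 : Integrable (fun x => f x ^ 2) (Measure.pi fun _ : ι => μ) := hL.integrable_sq
  have hmp : MeasurePreserving (fun z : ι → V × V => ((fun i => (z i).1), (fun i => (z i).2)))
      (Measure.pi fun _ => μ.prod μ) ((Measure.pi fun _ => μ).prod (Measure.pi fun _ => μ)) :=
    measurePreserving_arrowProdEquivProdArrow V V ι (fun _ => μ) (fun _ => μ)
  have hu : Measurable fun p : (ι → V) × (ι → V) => f p.1 * (f p.1 - f p.2) := by fun_prop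
  -- For an independent copy X' of X, Var f(X) = E[f(X)(f(X) - f(X'))].
  have key : variance f (Measure.pi fun _ => μ) =
      ∫ z, f (mixOn ∅ z) * (f (mixOn ∅ z) - f (mixOn Finset.univ z))
        ∂(Measure.pi fun _ => μ.prod μ) := by
    have e : ∫ z, f (mixOn ∅ z) * (f (mixOn ∅ z) - f (mixOn Finset.univ z))
        ∂(Measure.pi fun _ => μ.prod μ) =
        ∫ p, f p.1 * (f p.1 - f p.2) ∂((Measure.pi fun _ => μ).prod (Measure.pi fun _ => μ)) := by
      rw [← hmp.map_eq, integral_map hmp.measurable.aemeasurable hu.aestronglyMeasurable]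
      congr 1; funext z
      have h1 : mixOn ∅ z = fun i => (z i).1 := by funext i; simp [mixOn]
      have h2 : mixOn Finset.univ z = fun i => (z i).2 := by funext i; simp [mixOn]
      rw [h1, h2]
    rw [e, variance_eq_sub hL]
    have : ∀ p : (ι → V) × (ι → V), f p.1 * (f p.1 - f p.2) = f p.1 ^ 2 * 1 - f p.1 * f p.2 :=
      fun p => by ring
    simp_rw [this]
    rw [integral_sub (hi2.mul_prod (integrable_const (1 : ℝ))) (hi.mul_prod hi),
      integral_prod_mul (fun x => f x ^ 2) (fun _ : ι → V => (1 : ℝ)), integral_prod_mul]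
    simp [pow_two]
  rw [key]
  refine (integral_mul_sub_mixOn_le μ hf hM Finset.univ).trans (le_of_eq ?_)
  exact Finset.sum_congr rfl fun k _ => integral_sq_sub_mixOn_singleton μ hf hM k

end EfronStein

/-! ### Tours as full cycles, and moving one node of a tour -/

section Tours

open Equiv Equiv.Perm

/-- A spanning cycle of the complete graph on `Fin n`, as the permutation that sends each node to
its successor. -/
def IsTour {n : ℕ} (τ : Perm (Fin n)) : Prop := τ.IsCycle ∧ τ.support = Finset.univ

theorem IsTour.ne {n : ℕ} {τ : Perm (Fin n)} (h : IsTour τ) (i : Fin n) : τ i ≠ i :=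
  mem_support.1 (h.2 ▸ Finset.mem_univ i)

/-- Conjugating the rotation by an ordering gives its successor map. All full cycles arise this way,
so minimizing over orderings is minimizing over tours. -/
theorem cycleWeight_eq_sum_conj {V : Type*} (h : V → V → ℝ) (α : ℝ) {n : ℕ} (x : Fin n → V)
    (σ : Perm (Fin n)) :
    cycleWeight h α x σ = ∑ k, h (x k) (x ((σ * finRotate n * σ⁻¹) k)) ^ α := by
  unfold cycleWeight
  rw [← Equiv.sum_comp σ (fun k => h (x k) (x ((σ * finRotate n * σ⁻¹) k)) ^ α)]
  simp

theorem exists_isTour_sum_eq_tspWeight {V : Type*} (h : V → V → ℝ) (α : ℝ) {n : ℕ} (hn : 2 ≤ n)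
    (x : Fin n → V) : ∃ τ : Perm (Fin n), IsTour τ ∧
      ∑ k, h (x k) (x (τ k)) ^ α = tspWeight h α x := by
  obtain ⟨σ, -, hσ⟩ := Finset.exists_mem_eq_inf' (Finset.univ_nonempty (α := Perm (Fin n)))
    (cycleWeight h α x)
  refine ⟨σ * finRotate n * σ⁻¹, ⟨(isCycle_finRotate_of_le hn).conj, ?_⟩, ?_⟩
  · rw [support_conj, support_finRotate_of_le hn]
    ext; simp
  · rw [← cycleWeight_eq_sum_conj, tspWeight, hσ]

theorem IsTour.tspWeight_le {V : Type*} (h : V → V → ℝ) (α : ℝ) {n : ℕ}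
    (x : Fin n → V) {τ : Perm (Fin n)} (hτ : IsTour τ) :
    tspWeight h α x ≤ ∑ k, h (x k) (x (τ k)) ^ α := by
  have hn : 2 ≤ n := by
    have := hτ.1.two_le_card_support
    rwa [hτ.2, Finset.card_univ, Fintype.card_fin] at this
  have hc : IsConj (finRotate n) τ := (isCycle_finRotate_of_le hn).isConj hτ.1 (by
    rw [hτ.2, support_finRotate_of_le hn])
  obtain ⟨σ, hσ⟩ := isConj_iff.1 hc
  rw [← hσ, ← cycleWeight_eq_sum_conj]
  exact Finset.inf'_le _ (Finset.mem_univ _)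

/-- Moving the node `i` of a tour in front of the node `j` gives a tour. -/
theorem IsTour.swap_mul_swap_mul {n : ℕ} (hn : 3 ≤ n) {τ : Perm (Fin n)} (hτ : IsTour τ)
    {i j : Fin n} (hij : j ≠ i) : IsTour (swap i j * (swap i (τ i) * τ)) := by
  -- `g` bypasses `i`: the predecessor of `i` now goes to `τ i`, and `i` is fixed.
  set g := swap i (τ i) * τ with hg
  have h1 : τ i ≠ i := hτ.ne i
  -- Otherwise the orbit of `i` has two elements, against `3 ≤ n`.
  have h2 : τ (τ i) ≠ i := by
    intro h
    have hs : τ.support = {i, τ i} := by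
      ext y
      refine ⟨fun hy => ?_, fun _ => hτ.2 ▸ Finset.mem_univ y⟩
      obtain ⟨k, rfl⟩ := (hτ.1.sameCycle h1 (mem_support.1 hy)).exists_nat_pow_eq
      have : ∀ k : ℕ, (τ ^ k) i = i ∨ (τ ^ k) i = τ i := by
        intro k
        induction k with
        | zero => simp
        | succ k ih =>
          rw [pow_succ', mul_apply]
          rcases ih with ih | ih <;> rw [ih] <;> simp [h]
      simpa using this k
    have hc := congrArg Finset.card hs
    rw [hτ.2, Finset.card_univ, Fintype.card_fin, Finset.card_pair h1.symm] at hc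
    omega
  have hgc : g.IsCycle := hτ.1.swap_mul h1 h2
  have hgi : g i = i := by simp [hg]
  have hgne : ∀ k, k ≠ i → g k ≠ k := by
    intro k hk
    rw [hg, mul_apply]
    by_cases hk1 : τ k = i
    · rw [hk1, swap_apply_left]
      intro h; rw [h] at h2; exact h2 hk1
    · have : τ k ≠ τ i := fun h => hk (τ.injective h)
      rw [swap_apply_of_ne_of_ne hk1 this]
      exact hτ.ne k
  have hgj := hgne j hij
  have hform : List.formPerm (toList g j) = g := by
    rw [formPerm_toList, hgc.cycleOf_eq hgj]
  have hil : i ∉ toList g j := by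
    rw [mem_toList_iff]
    rintro ⟨h, -⟩
    exact hij (h.symm.eq_of_left hgi).symm
  obtain ⟨l, hl⟩ : ∃ l, toList g j = j :: l := by
    have hne : toList g j ≠ [] := by
      simpa [toList_eq_nil_iff] using hgj
    obtain ⟨a, l, hal⟩ := List.exists_cons_of_ne_nil hne
    refine ⟨l, ?_⟩
    have h0 := toList_getElem_zero g j (mem_support.2 hgj)
    simp only [hal, List.getElem_cons_zero] at h0
    rw [hal, h0]
  have hnd : (i :: toList g j).Nodup := List.nodup_cons.2 ⟨hil, nodup_toList g j⟩
  -- Inserting `i` before `j` is prepending `i` to the cycle of `g` listed from `j`.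
  have hf : swap i j * g = List.formPerm (i :: toList g j) := by
    rw [hl, List.formPerm_cons_cons, ← hl, hform]
  rw [hf]
  refine ⟨List.isCycle_formPerm hnd (by simp [hl]), ?_⟩
  rw [List.support_formPerm_of_nodup _ hnd (by simp [hl])]
  ext k
  simp only [List.mem_toFinset, List.mem_cons, Finset.mem_univ, iff_true]
  by_cases hk : k = i
  · exact .inl hk
  · exact .inr (mem_toList_iff.2 ⟨hgc.sameCycle hgj (hgne k hk), mem_support.2 hgj⟩)

/-- The sum is at most three times the largest term, and 3 ^ α ≤ 9. -/
theorem add_three_rpow_le {α a b c : ℝ} (hα₀ : 0 ≤ α) (hα₂ : α ≤ 2) (ha : 0 ≤ a) (hb : 0 ≤ b)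
    (hc : 0 ≤ c) : (a + b + c) ^ α ≤ 9 * (a ^ α + b ^ α + c ^ α) := by
  have key : ∀ t : ℝ, 0 ≤ t → a + b + c ≤ 3 * t →
      t ^ α ≤ a ^ α + b ^ α + c ^ α → (a + b + c) ^ α ≤ 9 * (a ^ α + b ^ α + c ^ α) := by
    intro t ht h1 h2
    calc (a + b + c) ^ α ≤ (3 * t) ^ α := Real.rpow_le_rpow (by positivity) h1 hα₀
      _ = 3 ^ α * t ^ α := Real.mul_rpow (by norm_num) ht
      _ ≤ 3 ^ (2 : ℝ) * t ^ α := by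
        gcongr
        norm_num
      _ = 9 * t ^ α := by norm_num
      _ ≤ _ := by gcongr
  have ha' := Real.rpow_nonneg ha α
  have hb' := Real.rpow_nonneg hb α
  have hc' := Real.rpow_nonneg hc α
  rcases le_total a b with h1 | h1 <;> rcases le_total b c with h2 | h2 <;>
    rcases le_total a c with h3 | h3
  all_goals first
    | exact key a ha (by linarith) (by linarith)
    | exact key b hb (by linarith) (by linarith)
    | exact key c hc (by linarith) (by linarith)

/-- Only the edges leaving `i`, `τ⁻¹ i` and `τ⁻¹ j` change; `A`, `B`, `C` bound their new weights by
the triangle inequality for `dist`, as `h` need not satisfy one. The constant 19 = 1 + 9 + 9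
collects the occurrences of `dist y (x j) ^ α`. -/
theorem tspWeight_update_le {V : Type*} [PseudoMetricSpace V] {h : V → V → ℝ} {α c : ℝ}
    (hα₀ : 0 ≤ α) (hα₂ : α ≤ 2) (hc : 0 ≤ c) (h0 : ∀ x y, 0 ≤ h x y)
    (hd : ∀ x y, h x y ≤ c * dist x y) {n : ℕ} (hn : 3 ≤ n) (x : Fin n → V) {τ : Perm (Fin n)}
    (hτ : IsTour τ) {i j : Fin n} (hij : j ≠ i) (y : V) :
    tspWeight h α (Function.update x i y) ≤ ∑ k, h (x k) (x (τ k)) ^ α +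
      19 * c ^ α * (dist y (x j) ^ α + dist (x (τ⁻¹ j)) (x j) ^ α +
        dist (x (τ⁻¹ i)) (x i) ^ α + dist (x i) (x (τ i)) ^ α) := by
  have hw : ∀ u v, h u v ^ α ≤ c ^ α * dist u v ^ α := fun u v => by
    rw [← Real.mul_rpow hc dist_nonneg]
    exact Real.rpow_le_rpow (h0 _ _) (hd _ _) hα₀
  have hw3 : ∀ u v a b e, 0 ≤ a → 0 ≤ b → 0 ≤ e → dist u v ≤ a + b + e →
      h u v ^ α ≤ 9 * c ^ α * (a ^ α + b ^ α + e ^ α) := by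
    intro u v a b e ha hb he hle
    calc h u v ^ α ≤ c ^ α * dist u v ^ α := hw u v
      _ ≤ c ^ α * (9 * (a ^ α + b ^ α + e ^ α)) := by
        gcongr
        exact (Real.rpow_le_rpow dist_nonneg hle hα₀).trans (add_three_rpow_le hα₀ hα₂ ha hb he)
      _ = _ := by ring
  refine ((hτ.swap_mul_swap_mul hn hij).tspWeight_le h α (Function.update x i y)).trans ?_
  set A := c ^ α * dist y (x j) ^ α with hA
  -- The term `dist y (x j)` is needed when `τ i = j`: then `τ⁻¹ i` is again followed by `i`, now at
  -- `y`.
  set B := 9 * c ^ α * (dist (x (τ⁻¹ i)) (x i) ^ α + dist (x i) (x (τ i)) ^ α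
    + dist y (x j) ^ α) with hB
  set C := 9 * c ^ α * (dist (x (τ⁻¹ j)) (x j) ^ α + dist y (x j) ^ α + 0 ^ α) with hC
  have hp : ∀ u v : V, 0 ≤ dist u v ^ α := fun u v => Real.rpow_nonneg dist_nonneg α
  have hcp : 0 ≤ c ^ α := Real.rpow_nonneg hc α
  have h00 : (0 : ℝ) ≤ 0 ^ α := Real.rpow_nonneg le_rfl α
  have hA0 : 0 ≤ A := mul_nonneg hcp (hp _ _)
  have hB0 : 0 ≤ B := by have := hp (x (τ⁻¹ i)) (x i); have := hp (x i) (x (τ i)); have := hp y (x j); positivity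
  have hC0 : 0 ≤ C := by have := hp (x (τ⁻¹ j)) (x j); have := hp y (x j); positivity
  have hterm : ∀ k, h (Function.update x i y k)
        (Function.update x i y ((swap i j * (swap i (τ i) * τ)) k)) ^ α ≤
      h (x k) (x (τ k)) ^ α + (if k = i then A else 0) + (if k = τ⁻¹ i then B else 0)
        + (if k = τ⁻¹ j then C else 0) := by
    intro k
    have hk0 : 0 ≤ h (x k) (x (τ k)) ^ α := Real.rpow_nonneg (h0 _ _) α
    have hiB : 0 ≤ (if k = τ⁻¹ i then B else 0) := by split_ifs <;> simp [hB0]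
    have hiC : 0 ≤ (if k = τ⁻¹ j then C else 0) := by split_ifs <;> simp [hC0]
    have hiA : 0 ≤ (if k = i then A else 0) := by split_ifs <;> simp [hA0]
    simp only [mul_apply]
    by_cases hki : k = i
    · subst hki
      rw [swap_apply_right, swap_apply_left, Function.update_self, Function.update_of_ne hij,
        if_pos rfl]
      have := hw y (x j)
      linarith
    rw [Function.update_of_ne hki]
    by_cases hkp : τ k = i
    · have hk : k = τ⁻¹ i := by rw [← hkp]; simp
      rw [hkp, swap_apply_left, if_pos hk]
      rw [hkp] at hk0
      suffices h (x k) (Function.update x i y ((swap i j) (τ i))) ^ α ≤ B by linarith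
      rw [← hk] at hB
      by_cases hj : τ i = j
      · rw [hj, swap_apply_right, Function.update_self, hB, hj]
        refine hw3 _ _ _ _ _ dist_nonneg dist_nonneg dist_nonneg ?_
        have := dist_triangle4 (x k) (x i) (x j) y
        rwa [dist_comm (x j) y] at this
      · rw [swap_apply_of_ne_of_ne (hτ.ne i) hj, Function.update_of_ne (hτ.ne i), hB]
        refine hw3 _ _ _ _ _ dist_nonneg dist_nonneg dist_nonneg ?_
        have := dist_triangle (x k) (x i) (x (τ i))
        have := dist_nonneg (x := y) (y := x j)
        linarith
    · have hk2 : τ k ≠ τ i := fun h => hki (τ.injective h)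
      rw [swap_apply_of_ne_of_ne hkp hk2]
      by_cases hj : τ k = j
      · have hk : k = τ⁻¹ j := by rw [← hj]; simp
        rw [if_pos hk, hj, swap_apply_right, Function.update_self]
        rw [hj] at hk0
        suffices h (x k) y ^ α ≤ C by linarith
        rw [hC, ← hk]
        refine hw3 _ _ _ _ _ dist_nonneg dist_nonneg le_rfl ?_
        have := dist_triangle (x k) (x j) y
        rw [dist_comm (x j) y] at this
        linarith
      · rw [swap_apply_of_ne_of_ne hkp hj, Function.update_of_ne hkp]
        linarith
  refine (Finset.sum_le_sum fun k _ => hterm k).trans ?_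
  simp only [Finset.sum_add_distrib, Finset.sum_ite_eq', Finset.mem_univ, if_true]
  have h0j : (0 : ℝ) ^ α ≤ dist (x (τ⁻¹ j)) (x j) ^ α :=
    Real.rpow_le_rpow le_rfl dist_nonneg hα₀
  rw [hA, hB, hC]
  have := mul_nonneg hcp (hp (x (τ⁻¹ i)) (x i))
  have := mul_nonneg hcp (hp (x i) (x (τ i)))
  have := mul_nonneg hcp (hp (x (τ⁻¹ j)) (x j))
  have := mul_le_mul_of_nonneg_left h0j hcp
  nlinarith

end Tours

/-! ### The grid, its snake order, and a short tour along it -/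

section Grid

/-- The index of the row of the `m × m` grid on the unit square that contains the coordinate `t`. -/
noncomputable def gridCoord (m : ℕ) (t : ℝ) : ℕ := min ⌊(t + 1 / 2) * m⌋₊ (m - 1)

/-- The position of the cell `(r, c)` of the `m × m` grid when the cells are visited row by row,
every other row backwards. -/
def snakeIndex (m r c : ℕ) : ℕ := r * m + if Even r then c else m - 1 - c

/-- The snake position of the cell that contains `x`. -/
noncomputable def cellIndex (m : ℕ) (x : unitSquare) : ℕ :=
  snakeIndex m (gridCoord m (x.1 0)) (gridCoord m (x.1 1))

theorem gridCoord_lt {m : ℕ} (hm : 0 < m) (t : ℝ) : gridCoord m t < m := by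
  unfold gridCoord; omega

theorem gridCoord_bounds {m : ℕ} (hm : 0 < m) {t : ℝ} (ht : t ∈ Set.Icc (-(1 / 2) : ℝ) (1 / 2)) :
    t ∈ Set.Icc (gridCoord m t / m - 1 / 2 : ℝ) (gridCoord m t / m - 1 / 2 + 1 / m) := by
  have hm' : (0 : ℝ) < m := by exact_mod_cast hm
  have h0 : 0 ≤ (t + 1 / 2) * m := mul_nonneg (by linarith [ht.1]) hm'.le
  have hfl := Nat.floor_le h0
  have hlt := Nat.lt_floor_add_one ((t + 1 / 2) * m)
  have h1 : (gridCoord m t : ℝ) ≤ (t + 1 / 2) * m :=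
    le_trans (by exact_mod_cast min_le_left _ _) hfl
  have h2 : (t + 1 / 2) * m ≤ gridCoord m t + 1 := by
    unfold gridCoord
    rcases le_total ⌊(t + 1 / 2) * (m : ℝ)⌋₊ (m - 1) with h | h
    · rw [min_eq_left h]; exact hlt.le
    · rw [min_eq_right h, Nat.cast_sub (by omega : 1 ≤ m)]
      have : (t + 1 / 2) * m ≤ 1 * m := by gcongr; linarith [ht.2]
      push_cast; linarith
  constructor
  · have : (gridCoord m t : ℝ) / m ≤ t + 1 / 2 := (div_le_iff₀ hm').2 h1
    linarith
  · have : t + 1 / 2 ≤ ((gridCoord m t : ℝ) + 1) / m := (le_div_iff₀ hm').2 h2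
    rw [add_div] at this
    linarith

theorem gridCoord_eq {m r : ℕ} (hr : r < m) {t : ℝ}
    (ht : t ∈ Set.Ico (r / m - 1 / 2 : ℝ) (r / m - 1 / 2 + 1 / m)) :
    gridCoord m t = r ∧ t ∈ Set.Icc (-(1 / 2) : ℝ) (1 / 2) := by
  have hm' : (0 : ℝ) < m := by exact_mod_cast (by omega : 0 < m)
  have h1 : (r : ℝ) / m ≤ t + 1 / 2 := by linarith [ht.1]
  have h2 : t + 1 / 2 < ((r : ℝ) + 1) / m := by rw [add_div]; linarith [ht.2]
  have h0 : (0 : ℝ) ≤ r / m := by positivity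
  have h3 : ((r : ℝ) + 1) / m ≤ 1 := by
    rw [div_le_one hm']; exact_mod_cast hr
  refine ⟨?_, by linarith, by linarith⟩
  have : ⌊(t + 1 / 2) * (m : ℝ)⌋₊ = r := by
    rw [Nat.floor_eq_iff (mul_nonneg (by linarith) hm'.le)]
    exact ⟨(div_le_iff₀ hm').1 h1, (lt_div_iff₀ hm').1 h2⟩
  unfold gridCoord
  omega

theorem snakeIndex_lt {m r c : ℕ} (hr : r < m) (hc : c < m) : snakeIndex m r c < m ^ 2 := by
  unfold snakeIndex
  have : r * m + m ≤ m * m := by nlinarith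
  rw [pow_two]
  split_ifs <;> omega

theorem exists_snakeIndex_eq {m k : ℕ} (hk : k < m ^ 2) :
    ∃ r < m, ∃ c < m, snakeIndex m r c = k := by
  have hm : 0 < m := Nat.pos_of_ne_zero (by rintro rfl; simp at hk)
  have h1 := Nat.mod_lt k hm
  refine ⟨k / m, Nat.div_lt_of_lt_mul (by rwa [← pow_two]),
    if Even (k / m) then k % m else m - 1 - k % m, by split_ifs <;> omega, ?_⟩
  have h2 := Nat.div_add_mod' k m
  unfold snakeIndex
  split_ifs <;> omega

/-- At a change of row the direction reverses, so the column is kept. -/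
theorem snakeIndex_step {m r c r' c' : ℕ} (hc : c < m) (hc' : c' < m)
    (h1 : snakeIndex m r c ≤ snakeIndex m r' c') (h2 : snakeIndex m r' c' ≤ snakeIndex m r c + 1) :
    (r' ≤ r + 1 ∧ r ≤ r' + 1) ∧ (c' ≤ c + 1 ∧ c ≤ c' + 1) := by
  have key : ∀ e e' : ℕ, e < m → e' < m → r * m + e ≤ r' * m + e' → r' * m + e' ≤ r * m + e + 1 →
      (r' = r ∧ e ≤ e' ∧ e' ≤ e + 1) ∨ (r' = r + 1 ∧ e' = 0 ∧ e + 1 = m) := by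
    intro e e' he he' h1 h2
    rcases lt_trichotomy r' r with h | h | h
    · obtain ⟨d, rfl⟩ := Nat.exists_eq_add_of_lt h
      nlinarith
    · subst h; omega
    · obtain ⟨d, rfl⟩ := Nat.exists_eq_add_of_lt h
      have h3 : (r + d + 1) * m = r * m + d * m + m := by ring
      rcases Nat.eq_zero_or_pos d with rfl | hd
      · right
        rw [h3] at h1 h2
        refine ⟨rfl, ?_, ?_⟩ <;> omega
      · have : m ≤ d * m := Nat.le_mul_of_pos_left m hd
        omega
  unfold snakeIndex at h1 h2
  rcases key _ _ (by split_ifs <;> omega) (by split_ifs <;> omega) h1 h2 with ⟨h, h3, h4⟩ | ⟨h, h3, h4⟩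
  · subst h
    split_ifs at h3 h4 <;> omega
  · subst h
    by_cases he : Even r
    · rw [if_neg (by rwa [Nat.even_add_one, not_not])] at h3
      rw [if_pos he] at h4
      omega
    · rw [if_pos (by rwa [Nat.even_add_one])] at h3
      rw [if_neg he] at h4
      omega

theorem snakeIndex_inj {m r c r' c' : ℕ} (hc : c < m) (hc' : c' < m)
    (h : snakeIndex m r c = snakeIndex m r' c') : r = r' ∧ c = c' := by
  have hr : ∀ r c : ℕ, c < m → snakeIndex m r c / m = r := by
    intro r c hc
    unfold snakeIndex
    rw [add_comm, Nat.add_mul_div_right _ _ (by omega), Nat.div_eq_of_lt (by split_ifs <;> omega),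
      zero_add]
  have h1 : r = r' := by rw [← hr r c hc, h, hr r' c' hc']
  subst h1
  unfold snakeIndex at h
  split_ifs at h <;> omega

theorem cellIndex_lt {m : ℕ} (hm : 0 < m) (x : unitSquare) : cellIndex m x < m ^ 2 :=
  snakeIndex_lt (gridCoord_lt hm _) (gridCoord_lt hm _)

theorem dist_unitSquare_le {x y : unitSquare} {s : ℝ} (h : ∀ i, |x.1 i - y.1 i| ≤ s) :
    dist x y ≤ 2 * s := by
  have hs : 0 ≤ s := (abs_nonneg _).trans (h 0)
  rw [Subtype.dist_eq, EuclideanSpace.dist_eq, Fin.sum_univ_two]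
  refine Real.sqrt_le_iff.2 ⟨by linarith, ?_⟩
  simp only [Real.dist_eq]
  have h0 := pow_le_pow_left₀ (abs_nonneg _) (h 0) 2
  have h1 := pow_le_pow_left₀ (abs_nonneg _) (h 1) 2
  nlinarith [sq_nonneg s]

theorem dist_unitSquare_le_two (x y : unitSquare) : dist x y ≤ 2 := by
  have := dist_unitSquare_le (x := x) (y := y) (s := 1) fun i => by
    have h1 := x.2 i
    have h2 := y.2 i
    rw [abs_le]; constructor <;> linarith [h1.1, h1.2, h2.1, h2.2]
  linarith

theorem dist_le_of_cellIndex {m : ℕ} (hm : 0 < m) {x y : unitSquare}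
    (h1 : cellIndex m x ≤ cellIndex m y) (h2 : cellIndex m y ≤ cellIndex m x + 1) :
    dist x y ≤ 4 / m := by
  have hm' : (0 : ℝ) < m := by exact_mod_cast hm
  obtain ⟨⟨h3, h4⟩, h5, h6⟩ := snakeIndex_step (gridCoord_lt hm _) (gridCoord_lt hm _) h1 h2
  have key : ∀ s t : ℝ, s ∈ Set.Icc (-(1 / 2) : ℝ) (1 / 2) → t ∈ Set.Icc (-(1 / 2) : ℝ) (1 / 2) →
      gridCoord m t ≤ gridCoord m s + 1 → gridCoord m s ≤ gridCoord m t + 1 →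
      |s - t| ≤ 2 / m := by
    intro s t hs ht h h'
    have hs' := gridCoord_bounds hm hs
    have ht' := gridCoord_bounds hm ht
    have e : (gridCoord m t : ℝ) / m ≤ gridCoord m s / m + 1 / m := by
      rw [← add_div]; gcongr; exact_mod_cast h
    have e' : (gridCoord m s : ℝ) / m ≤ gridCoord m t / m + 1 / m := by
      rw [← add_div]; gcongr; exact_mod_cast h'
    have e2 : (2 : ℝ) / m = 1 / m + 1 / m := by ring
    rw [abs_le, e2]
    constructor <;> linarith [hs'.1, hs'.2, ht'.1, ht'.2]
  have := dist_unitSquare_le (x := x) (y := y) (s := 2 / m) fun i => by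
    fin_cases i
    · exact key _ _ (x.2 0) (y.2 0) h3 h4
    · exact key _ _ (x.2 1) (y.2 1) h5 h6
  calc dist x y ≤ 2 * (2 / m) := this
    _ = 4 / m := by ring

theorem measurable_gridCoord (m : ℕ) : Measurable (gridCoord m) := by
  unfold gridCoord
  exact (Nat.measurable_floor.comp (by fun_prop)).min measurable_const

theorem measurable_cellIndex (m : ℕ) : Measurable (cellIndex m) := by
  have h : ∀ i, Measurable fun x : unitSquare => gridCoord m (x.1 i) := fun i =>
    (measurable_gridCoord m).comp (by fun_prop)
  have h2 : Measurable fun p : ℕ × ℕ => snakeIndex m p.1 p.2 := measurable_of_countable _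
  exact h2.comp ((h 0).prodMk (h 1))

theorem volume_box (I J : Set ℝ) (hI : MeasurableSet I) (hJ : MeasurableSet J) :
    (volume : Measure (EuclideanSpace ℝ (Fin 2))) {x | x 0 ∈ I ∧ x 1 ∈ J} = volume I * volume J := by
  have hset : {x : EuclideanSpace ℝ (Fin 2) | x 0 ∈ I ∧ x 1 ∈ J} =
      WithLp.ofLp ⁻¹' (Set.univ.pi ![I, J]) := by
    ext x
    simp [Set.mem_pi, Fin.forall_fin_two]
  rw [hset, (PiLp.volume_preserving_ofLp (Fin 2)).measure_preimage, volume_pi_pi]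
  · simp
  · refine (MeasurableSet.univ_pi fun i => ?_).nullMeasurableSet
    fin_cases i
    · exact hI
    · exact hJ

theorem measurableSet_unitSquare : MeasurableSet unitSquare := by
  have : unitSquare = ⋂ i, {x : EuclideanSpace ℝ (Fin 2) | x i ∈ Set.Icc (-(1 / 2) : ℝ) (1 / 2)} := by
    ext; simp [unitSquare]
  rw [this]
  exact MeasurableSet.iInter fun i => measurableSet_Icc.preimage (by fun_prop)

/-- The cell lies between a half-open and a closed square of equal area, so its exact boundary is
irrelevant. -/
theorem comap_volume_cell {m k : ℕ} (hk : k < m ^ 2) :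
    ((volume : Measure (EuclideanSpace ℝ (Fin 2))).comap
      (Subtype.val : unitSquare → EuclideanSpace ℝ (Fin 2))) {x | cellIndex m x = k} =
      ENNReal.ofReal ((1 / m) ^ 2) := by
  obtain ⟨r, hr, c, hc, rfl⟩ := exists_snakeIndex_eq hk
  have hm : 0 < m := by omega
  have hvol : ∀ I J : Set ℝ, volume I = ENNReal.ofReal (1 / m) → volume J = ENNReal.ofReal (1 / m) →
      MeasurableSet I → MeasurableSet J →
      (volume : Measure (EuclideanSpace ℝ (Fin 2))) {x | x 0 ∈ I ∧ x 1 ∈ J} =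
        ENNReal.ofReal ((1 / m) ^ 2) := by
    intro I J hI hJ mI mJ
    rw [volume_box I J mI mJ, hI, hJ, ← ENNReal.ofReal_mul (by positivity), pow_two]
  rw [(MeasurableEmbedding.subtype_coe measurableSet_unitSquare).comap_apply]
  apply le_antisymm
  · rw [← hvol (Set.Icc (r / m - 1 / 2 : ℝ) (r / m - 1 / 2 + 1 / m))
      (Set.Icc (c / m - 1 / 2 : ℝ) (c / m - 1 / 2 + 1 / m)) (by rw [Real.volume_Icc]; congr 1; ring)
      (by rw [Real.volume_Icc]; congr 1; ring) measurableSet_Icc measurableSet_Icc]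
    refine measure_mono ?_
    rintro _ ⟨x, hx, rfl⟩
    obtain ⟨h1, h2⟩ := snakeIndex_inj (gridCoord_lt hm _) hc hx
    exact ⟨h1 ▸ gridCoord_bounds hm (x.2 0), h2 ▸ gridCoord_bounds hm (x.2 1)⟩
  · rw [← hvol (Set.Ico (r / m - 1 / 2 : ℝ) (r / m - 1 / 2 + 1 / m))
      (Set.Ico (c / m - 1 / 2 : ℝ) (c / m - 1 / 2 + 1 / m)) (by rw [Real.volume_Ico]; congr 1; ring)
      (by rw [Real.volume_Ico]; congr 1; ring) measurableSet_Ico measurableSet_Ico]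
    refine measure_mono ?_
    rintro x ⟨h0, h1⟩
    obtain ⟨e0, m0⟩ := gridCoord_eq hr h0
    obtain ⟨e1, m1⟩ := gridCoord_eq hc h1
    refine ⟨⟨x, fun i => ?_⟩, ?_, rfl⟩
    · fin_cases i
      · exact m0
      · exact m1
    · simp only [Set.mem_ofPred_eq, cellIndex, e0, e1]

/-- If every cell of the `m × m` grid contains a node, then following the snake gives a tour all of
whose edges but one have length at most `4 / m`. -/
theorem tspWeight_le_of_cells_nonempty {h : unitSquare → unitSquare → ℝ} {α c : ℝ} (hα₀ : 0 ≤ α)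
    (hc : 0 ≤ c) (h0 : ∀ x y, 0 ≤ h x y) (hd : ∀ x y, h x y ≤ c * dist x y) {m n : ℕ} (hm : 0 < m)
    (x : Fin n → unitSquare) (hx : ∀ k < m ^ 2, ∃ i, cellIndex m (x i) = k) :
    tspWeight h α x ≤ c ^ α * (n * (4 / m) ^ α + 2 ^ α) := by
  have hcp : 0 ≤ c ^ α := Real.rpow_nonneg hc α
  have hn : 0 < n := by
    obtain ⟨i, -⟩ := hx 0 (by positivity)
    exact i.pos
  have hw : ∀ u v : unitSquare, ∀ s, dist u v ≤ s → h u v ^ α ≤ c ^ α * s ^ α := fun u v s hs => by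
    rw [← Real.mul_rpow hc (dist_nonneg.trans hs)]
    exact Real.rpow_le_rpow (h0 _ _) ((hd _ _).trans (by gcongr)) hα₀
  set σ := Tuple.sort fun i => cellIndex m (x i) with hσ
  have hmono : Monotone fun i => cellIndex m (x (σ i)) :=
    Tuple.monotone_sort fun i => cellIndex m (x i)
  refine (Finset.inf'_le _ (Finset.mem_univ σ)).trans ?_
  -- The exceptional index `n - 1` is the edge that closes the tour.
  have hterm : ∀ i : Fin n, h (x (σ i)) (x (σ (finRotate n i))) ^ α ≤
      c ^ α * (4 / m) ^ α + if i = ⟨n - 1, by omega⟩ then c ^ α * 2 ^ α else 0 := by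
    intro i
    split_ifs with hi
    · refine (hw _ _ _ (dist_unitSquare_le_two _ _)).trans ?_
      have : 0 ≤ c ^ α * (4 / m : ℝ) ^ α := by positivity
      linarith
    · rw [add_zero]
      refine hw _ _ _ ?_
      have hi' : i.1 + 1 < n := by
        have : i.1 ≠ n - 1 := fun h => hi (Fin.ext h)
        omega
      have hrot : finRotate n i = ⟨i.1 + 1, hi'⟩ := by
        obtain ⟨N, rfl⟩ : ∃ N, n = N + 1 := ⟨n - 1, by omega⟩
        exact finRotate_of_lt (by omega)
      rw [hrot]
      refine dist_le_of_cellIndex hm (hmono (Fin.le_def.2 (Nat.le_succ _))) ?_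
      -- If the snake position jumped by two or more, a node of the skipped cell would be sorted
      -- strictly between positions `i` and `i + 1`.
      by_contra hlt
      push Not at hlt
      obtain ⟨l, hl⟩ := hx (cellIndex m (x (σ i)) + 1) (hlt.trans (cellIndex_lt hm _))
      obtain ⟨l', rfl⟩ := σ.surjective l
      have h1 : i < l' := by
        by_contra hle
        have := hmono (not_lt.1 hle)
        simp only at this
        omega
      have h2 : l' < ⟨i.1 + 1, hi'⟩ := by
        by_contra hle
        have := hmono (not_lt.1 hle)
        simp only at this
        omega
      rw [Fin.lt_def] at h1 h2
      simp only at h2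
      omega
  unfold cycleWeight
  refine (Finset.sum_le_sum fun i _ => hterm i).trans (le_of_eq ?_)
  rw [Finset.sum_add_distrib, Finset.sum_ite_eq']
  simp
  ring

end Grid

/-! ### The variance bound for a fixed grid -/

section Variance

theorem integral_comp_cellIndex_le (μ : Measure unitSquare) [IsProbabilityMeasure μ] {m : ℕ}
    (hm : 0 < m) {q : ℝ} (hq : ∀ k < m ^ 2, μ.real {x | cellIndex m x = k} ≤ q) {G : ℕ → ℝ}
    (hG : ∀ k, 0 ≤ G k) :
    Integrable (fun y => G (cellIndex m y)) μ ∧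
      ∫ y, G (cellIndex m y) ∂μ ≤ q * ∑ k ∈ Finset.range (m ^ 2), G k := by
  have hms : ∀ k, MeasurableSet {y : unitSquare | cellIndex m y = k} := fun k =>
    measurableSet_eq_fun (measurable_cellIndex m) measurable_const
  have heq : (fun y => G (cellIndex m y)) = fun y => ∑ k ∈ Finset.range (m ^ 2),
      {y : unitSquare | cellIndex m y = k}.indicator (fun _ => G k) y := by
    funext y
    simp only [Set.indicator_apply, Set.mem_ofPred_eq]
    rw [Finset.sum_ite_eq, if_pos (Finset.mem_range.2 (cellIndex_lt hm y))]
  have hint : ∀ k, Integrable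
      (fun y => {y : unitSquare | cellIndex m y = k}.indicator (fun _ => G k) y) μ :=
    fun k => (integrable_const (G k)).indicator (hms k)
  rw [heq]
  refine ⟨integrable_finsetSum _ fun k _ => hint k, ?_⟩
  rw [integral_finsetSum _ fun k _ => hint k, Finset.mul_sum]
  refine Finset.sum_le_sum fun k hk => ?_
  rw [integral_indicator_const _ (hms k), smul_eq_mul]
  exact mul_le_mul_of_nonneg_right (hq k (Finset.mem_range.1 hk)) (hG k)

/-- Each tour edge is charged twice as an edge at the moved node `i`. As an edge entering `j` it is
charged with probability at most `q` for each `i`, hence the factor 1 + nq. The lower bound on `h`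
turns the weight of the optimal tour into a bound on `A`. -/
theorem sum_integral_update_le {h : unitSquare → unitSquare → ℝ} {α c₁ c₂ : ℝ} (hα₀ : 0 < α)
    (hα₂ : α < 2) (hc₁ : 0 < c₁) (hc₂ : 0 < c₂)
    (hh : ∀ x y, c₁ * dist x y ≤ h x y ∧ h x y ≤ c₂ * dist x y)
    (μ : Measure unitSquare) [IsProbabilityMeasure μ] {m n : ℕ} (hm : 0 < m) (hn : 3 ≤ n) {q : ℝ}
    (hq : ∀ k < m ^ 2, μ.real {x | cellIndex m x = k} ≤ q) (x : Fin n → unitSquare)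
    (hx : ∀ i, ∀ k < m ^ 2, ∃ j ≠ i, cellIndex m (x j) = k) :
    ∑ i, ∫ y, (max (tspWeight h α (Function.update x i y) - tspWeight h α x) 0) ^ 2 ∂μ ≤
      5776 * (c₂ ^ α) ^ 2 * (1 + 2 * (c₂ ^ α / c₁ ^ α)) * (1 + n * q) *
        (n * (4 / m) ^ α + 4) := by
  have h0 : ∀ x y, 0 ≤ h x y := fun x y => (mul_nonneg hc₁.le dist_nonneg).trans (hh x y).1
  have hd : ∀ x y, h x y ≤ c₂ * dist x y := fun x y => (hh x y).2
  have hq0 : 0 ≤ q := measureReal_nonneg.trans (hq 0 (by positivity))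
  have hc₁p : 0 < c₁ ^ α := Real.rpow_pos_of_pos hc₁ α
  have hc₂p : 0 < c₂ ^ α := Real.rpow_pos_of_pos hc₂ α
  have h2α : (2 : ℝ) ^ α ≤ 4 := by
    calc (2 : ℝ) ^ α ≤ 2 ^ (2 : ℝ) := Real.rpow_le_rpow_of_exponent_le (by norm_num) hα₂.le
      _ = 4 := by norm_num
  have hd4 : ∀ u v : unitSquare, dist u v ^ α ≤ 4 := fun u v =>
    (Real.rpow_le_rpow dist_nonneg (dist_unitSquare_le_two u v) hα₀.le).trans h2α
  have hd0 : ∀ u v : unitSquare, 0 ≤ dist u v ^ α := fun u v => Real.rpow_nonneg dist_nonneg α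
  obtain ⟨τ, hτ, hτT⟩ := exists_isTour_sum_eq_tspWeight h α (by omega : 2 ≤ n) x
  set t : ℝ := (4 / m) ^ α with ht
  have ht0 : 0 ≤ t := by positivity
  set a : Fin n → ℝ := fun k => dist (x k) (x (τ k)) ^ α with ha
  have ha0 : ∀ k, 0 ≤ a k := fun k => hd0 _ _
  set A := ∑ k, a k with hA
  have hA0 : 0 ≤ A := Finset.sum_nonneg fun k _ => ha0 k
  have hAB : A ≤ c₂ ^ α / c₁ ^ α * (n * t + 4) := by
    have h1 : c₁ ^ α * A ≤ tspWeight h α x := by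
      rw [← hτT, hA, Finset.mul_sum]
      refine Finset.sum_le_sum fun k _ => ?_
      rw [ha, ← Real.mul_rpow hc₁.le dist_nonneg]
      exact Real.rpow_le_rpow (by positivity) (hh _ _).1 hα₀.le
    have h2 : tspWeight h α x ≤ c₂ ^ α * (n * t + 2 ^ α) :=
      tspWeight_le_of_cells_nonempty hα₀.le hc₂.le h0 hd hm x fun k hk => by
        obtain ⟨j, -, hj⟩ := hx ⟨0, by omega⟩ k hk
        exact ⟨j, hj⟩
    have h3 : c₂ ^ α * (n * t + 2 ^ α) ≤ c₂ ^ α * (n * t + 4) := by gcongr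
    rw [div_mul_eq_mul_div, le_div_iff₀ hc₁p, mul_comm]
    linarith
  choose! J hJne hJ using hx
  set K := 5776 * (c₂ ^ α) ^ 2 with hK
  have hK0 : 0 ≤ K := by positivity
  have hpt : ∀ i y, (max (tspWeight h α (Function.update x i y) - tspWeight h α x) 0) ^ 2 ≤
      K * (t + a (τ⁻¹ i) + a i) + K * a (τ⁻¹ (J i (cellIndex m y))) := by
    intro i y
    have hlt := cellIndex_lt hm y
    set j := J i (cellIndex m y) with hj
    have e1 := tspWeight_update_le hα₀.le hα₂.le hc₂.le h0 hd hn x hτ (hJne i _ hlt) y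
    rw [hτT, ← hj] at e1
    have ht1 : dist y (x j) ^ α ≤ t := by
      refine Real.rpow_le_rpow dist_nonneg (dist_le_of_cellIndex hm ?_ ?_) hα₀.le <;>
        rw [hj, hJ i _ hlt]
      omega
    have e2 : dist (x (τ⁻¹ j)) (x j) ^ α = a (τ⁻¹ j) := by simp [ha]
    have e3 : dist (x (τ⁻¹ i)) (x i) ^ α = a (τ⁻¹ i) := by simp [ha]
    rw [e2, e3] at e1
    set d := dist y (x j) ^ α with hdd
    have hd00 : 0 ≤ d := hd0 _ _
    have hd44 : d ≤ 4 := hd4 _ _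
    have b1 : a (τ⁻¹ j) ≤ 4 := hd4 _ _
    have b2 : a (τ⁻¹ i) ≤ 4 := hd4 _ _
    have b3 : a i ≤ 4 := hd4 _ _
    have p1 := ha0 (τ⁻¹ j)
    have p2 := ha0 (τ⁻¹ i)
    have p3 := ha0 i
    have e4 : max (tspWeight h α (Function.update x i y) - tspWeight h α x) 0 ≤
        19 * c₂ ^ α * (d + a (τ⁻¹ j) + a (τ⁻¹ i) + a i) := by
      refine max_le ?_ (by positivity)
      change tspWeight h α (Function.update x i y) ≤ tspWeight h α x +
        19 * c₂ ^ α * (d + a (τ⁻¹ j) + a (τ⁻¹ i) + a i) at e1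
      linarith
    -- Each of the four terms is at most 4, so squaring costs a factor 16; this gives 5776 = 19² ·
    -- 16 in `K`.
    have e5 : (d + a (τ⁻¹ j) + a (τ⁻¹ i) + a i) ^ 2 ≤
        16 * (t + a (τ⁻¹ j) + a (τ⁻¹ i) + a i) := by
      calc (d + a (τ⁻¹ j) + a (τ⁻¹ i) + a i) ^ 2
          ≤ 16 * (d + a (τ⁻¹ j) + a (τ⁻¹ i) + a i) := by
            rw [pow_two]
            exact mul_le_mul_of_nonneg_right (by linarith) (by positivity)
        _ ≤ _ := by linarith
    calc _ ≤ (19 * c₂ ^ α * (d + a (τ⁻¹ j) + a (τ⁻¹ i) + a i)) ^ 2 :=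
          pow_le_pow_left₀ (le_max_right _ _) e4 2
      _ = 361 * (c₂ ^ α) ^ 2 * (d + a (τ⁻¹ j) + a (τ⁻¹ i) + a i) ^ 2 := by ring
      _ ≤ 361 * (c₂ ^ α) ^ 2 * (16 * (t + a (τ⁻¹ j) + a (τ⁻¹ i) + a i)) := by gcongr
      _ = _ := by rw [hK]; ring
  have hi : ∀ i, ∫ y, (max (tspWeight h α (Function.update x i y) - tspWeight h α x) 0) ^ 2 ∂μ ≤
      K * (t + a (τ⁻¹ i) + a i) + K * (q * A) := by
    intro i
    obtain ⟨g1, g2⟩ := integral_comp_cellIndex_le μ hm hq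
      (G := fun k => a (τ⁻¹ (J i k))) fun k => ha0 _
    have hsum : ∑ k ∈ Finset.range (m ^ 2), a (τ⁻¹ (J i k)) ≤ A := by
      -- Representatives of different cells are different nodes, so no edge is counted twice.
      have hinj : Set.InjOn (fun k => τ⁻¹ (J i k)) (Finset.range (m ^ 2)) := by
        intro k hk k' hk' hkk
        have := (τ⁻¹).injective hkk
        rw [← hJ i k (by simpa using hk), ← hJ i k' (by simpa using hk'), this]
      rw [← Finset.sum_image (f := a) hinj]
      exact Finset.sum_le_sum_of_subset_of_nonneg (Finset.subset_univ _) fun k _ _ => ha0 k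
    refine (integral_mono_of_nonneg (.of_forall fun y => sq_nonneg _)
      ((integrable_const (K * (t + a (τ⁻¹ i) + a i))).add (g1.const_mul K))
      (.of_forall (hpt i))).trans ?_
    simp only [Pi.add_apply]
    rw [integral_add (integrable_const _) (g1.const_mul K), integral_const, integral_const_mul]
    simp only [probReal_univ, one_smul]
    gcongr
    exact g2.trans (by gcongr)
  refine (Finset.sum_le_sum fun i _ => hi i).trans ?_
  have hs : ∑ i, a (τ⁻¹ i) = A := Equiv.sum_comp (τ⁻¹) a
  have hSum : ∑ i, (K * (t + a (τ⁻¹ i) + a i) + K * (q * A)) =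
      K * (n * t + 2 * A + n * q * A) := by
    rw [Finset.sum_add_distrib, ← Finset.mul_sum, Finset.sum_add_distrib, Finset.sum_add_distrib, hs]
    simp
    ring
  rw [hSum, mul_assoc K, mul_assoc K]
  refine mul_le_mul_of_nonneg_left ?_ hK0
  set R := c₂ ^ α / c₁ ^ α with hR
  have hR0 : 0 ≤ R := by positivity
  set B := n * t + 4 with hB
  have hB0 : 0 ≤ B := by positivity
  have hnq : 0 ≤ n * q := by positivity
  have h1 : n * q * A ≤ n * q * (R * B) := by gcongr
  have h2 : 0 ≤ n * q * B := by positivity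
  have h3 : 0 ≤ n * q * (R * B) := by positivity
  nlinarith

/-- Union bound over `i` and `k`; the other n - 1 independent nodes all miss a cell with probability
at most (1 - p)^(n-1). -/
theorem measure_exists_cell_avoided_le (μ : Measure unitSquare) [IsProbabilityMeasure μ] {m n : ℕ}
    {p : ℝ} (hp : ∀ k < m ^ 2, p ≤ μ.real {x | cellIndex m x = k}) :
    (Measure.pi fun _ : Fin n => μ).real
      {x | ∃ i, ∃ k < m ^ 2, ∀ j ≠ i, cellIndex m (x j) ≠ k} ≤
      n * m ^ 2 * Real.exp (-(p * (n - 1 : ℕ))) := by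
  have hset : {x : Fin n → unitSquare | ∃ i, ∃ k < m ^ 2, ∀ j ≠ i, cellIndex m (x j) ≠ k} =
      ⋃ i ∈ (Finset.univ : Finset (Fin n)), ⋃ k ∈ Finset.range (m ^ 2), Set.univ.pi fun j =>
        if j = i then Set.univ else {y : unitSquare | cellIndex m y ≠ k} := by
    ext x
    simp only [Set.mem_ofPred_eq, Set.mem_iUnion, Finset.mem_univ, Finset.mem_range, Set.mem_pi,
      exists_prop, true_and]
    refine exists_congr fun i => exists_congr fun k => and_congr_right fun _ =>
      forall_congr' fun j => ?_
    by_cases hj : j = i <;> simp [hj]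
  rw [hset]
  have hone : ∀ i : Fin n, ∀ k < m ^ 2, (Measure.pi fun _ : Fin n => μ).real
      (Set.univ.pi fun j => if j = i then Set.univ else {y : unitSquare | cellIndex m y ≠ k}) ≤
      Real.exp (-(p * (n - 1 : ℕ))) := by
    intro i k hk
    have hcompl : μ.real {y : unitSquare | cellIndex m y ≠ k} ≤ Real.exp (-p) := by
      have : {y : unitSquare | cellIndex m y ≠ k} = {y : unitSquare | cellIndex m y = k}ᶜ := rfl
      rw [this, probReal_compl_eq_one_sub
        (measurableSet_eq_fun (measurable_cellIndex m) measurable_const)]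
      have := Real.add_one_le_exp (-p)
      linarith [hp k hk]
    rw [measureReal_def, Measure.pi_pi, ENNReal.toReal_prod,
      ← Finset.mul_prod_erase _ _ (Finset.mem_univ i)]
    simp only [if_true, measure_univ, ENNReal.toReal_one, one_mul]
    calc ∏ j ∈ Finset.univ.erase i,
          (μ (if j = i then Set.univ else {y : unitSquare | cellIndex m y ≠ k})).toReal
        ≤ ∏ j ∈ Finset.univ.erase i, Real.exp (-p) := by
          refine Finset.prod_le_prod (fun j _ => ENNReal.toReal_nonneg) fun j hj => ?_
          rw [if_neg (Finset.ne_of_mem_erase hj)]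
          exact hcompl
      _ = Real.exp (-(p * (n - 1 : ℕ))) := by
          rw [Finset.prod_const, Finset.card_erase_of_mem (Finset.mem_univ i), Finset.card_univ,
            Fintype.card_fin, ← Real.exp_nat_mul]
          congr 1; ring
  refine (measureReal_biUnion_finset_le _ _).trans ?_
  calc _ ≤ ∑ i : Fin n, ∑ k ∈ Finset.range (m ^ 2), Real.exp (-(p * (n - 1 : ℕ))) := by
        refine Finset.sum_le_sum fun i _ => (measureReal_biUnion_finset_le _ _).trans ?_
        exact Finset.sum_le_sum fun k hk => hone i k (Finset.mem_range.1 hk)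
    _ = _ := by simp; ring

theorem tspWeight_nonneg {V : Type*} {h : V → V → ℝ} {α : ℝ} (h0 : ∀ x y, 0 ≤ h x y) {n : ℕ}
    (x : Fin n → V) : 0 ≤ tspWeight h α x :=
  Finset.le_inf' _ _ fun _ _ => Finset.sum_nonneg fun _ _ => Real.rpow_nonneg (h0 _ _) α

theorem tspWeight_le_mul_card {h : unitSquare → unitSquare → ℝ} {α c : ℝ} (hα₀ : 0 ≤ α)
    (hα₂ : α ≤ 2) (hc : 0 ≤ c) (h0 : ∀ x y, 0 ≤ h x y) (hd : ∀ x y, h x y ≤ c * dist x y) {n : ℕ}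
    (x : Fin n → unitSquare) : tspWeight h α x ≤ n * (c ^ α * 4) := by
  refine (Finset.inf'_le _ (Finset.mem_univ 1)).trans ?_
  unfold cycleWeight
  refine (Finset.sum_le_card_nsmul _ _ (c ^ α * 4) fun i _ => ?_).trans (by simp)
  calc _ ≤ (c * 2) ^ α := Real.rpow_le_rpow (h0 _ _)
        ((hd _ _).trans (mul_le_mul_of_nonneg_left (dist_unitSquare_le_two _ _) hc)) hα₀
    _ = c ^ α * 2 ^ α := Real.mul_rpow hc (by norm_num)
    _ ≤ c ^ α * 2 ^ (2 : ℝ) := by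
        gcongr
        norm_num
    _ = c ^ α * 4 := by norm_num

theorem measurable_tspWeight {V : Type*} [MeasurableSpace V] {h : V → V → ℝ}
    (hm : Measurable fun p : V × V => h p.1 p.2) (α : ℝ) (n : ℕ) :
    Measurable (tspWeight h α : (Fin n → V) → ℝ) := by
  have : (tspWeight h α : (Fin n → V) → ℝ) =
      Finset.univ.inf' Finset.univ_nonempty fun σ x => cycleWeight h α x σ := by
    funext x
    rw [Finset.inf'_apply]
    rfl
  rw [this]
  refine Finset.inf'_induction _ _ (fun _ hf _ hg => hf.inf hg) fun σ _ => ?_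
  unfold cycleWeight
  refine Finset.measurable_sum _ fun i _ => ?_
  have h1 : Measurable fun x : Fin n → V => (x (σ i), x (σ (finRotate n i))) := by fun_prop
  exact (hm.comp h1).pow_const α

/-- A variance bound in terms of the mesh `1 / m` of a grid whose cells have probability between
`p` and `q`. -/
theorem variance_tspWeight_le {h : unitSquare → unitSquare → ℝ} {α c₁ c₂ : ℝ} (hα₀ : 0 < α)
    (hα₂ : α < 2) (hc₁ : 0 < c₁) (hc₂ : 0 < c₂)
    (hmeas : Measurable fun p : unitSquare × unitSquare => h p.1 p.2)
    (hh : ∀ x y, c₁ * dist x y ≤ h x y ∧ h x y ≤ c₂ * dist x y)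
    (μ : Measure unitSquare) [IsProbabilityMeasure μ] {m n : ℕ} (hm : 0 < m) (hn : 3 ≤ n) {p q : ℝ}
    (hp : ∀ k < m ^ 2, p ≤ μ.real {x | cellIndex m x = k})
    (hq : ∀ k < m ^ 2, μ.real {x | cellIndex m x = k} ≤ q) :
    variance (tspWeight h α) (Measure.pi fun _ : Fin n => μ) ≤
      5776 * (c₂ ^ α) ^ 2 * (1 + 2 * (c₂ ^ α / c₁ ^ α)) * (1 + n * q) * (n * (4 / m) ^ α + 4) +
        n * m ^ 2 * Real.exp (-(p * (n - 1 : ℕ))) * (n * (n * (c₂ ^ α * 4)) ^ 2) := by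
  have h0 : ∀ x y, 0 ≤ h x y := fun x y => (mul_nonneg hc₁.le dist_nonneg).trans (hh x y).1
  have hd : ∀ x y, h x y ≤ c₂ * dist x y := fun x y => (hh x y).2
  have hT0 : ∀ x : Fin n → unitSquare, 0 ≤ tspWeight h α x := fun x => tspWeight_nonneg h0 x
  have hTM : ∀ x : Fin n → unitSquare, tspWeight h α x ≤ n * (c₂ ^ α * 4) := fun x =>
    tspWeight_le_mul_card hα₀.le hα₂.le hc₂.le h0 hd x
  have hTm := measurable_tspWeight hmeas α n
  set M : ℝ := n * (c₂ ^ α * 4) with hM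
  set B := 5776 * (c₂ ^ α) ^ 2 * (1 + 2 * (c₂ ^ α / c₁ ^ α)) * (1 + n * q) *
    (n * (4 / m) ^ α + 4) with hB
  have hq0 : 0 ≤ q := measureReal_nonneg.trans (hq 0 (by positivity))
  have hB0 : 0 ≤ B := by positivity
  set bad : Set (Fin n → unitSquare) :=
    {x | ∃ i, ∃ k < m ^ 2, ∀ j ≠ i, cellIndex m (x j) ≠ k} with hbad
  have hbadm : MeasurableSet bad := by
    have hc : ∀ j k, MeasurableSet {x : Fin n → unitSquare | cellIndex m (x j) ≠ k} := fun j k =>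
      (measurableSet_eq_fun ((measurable_cellIndex m).comp (measurable_pi_apply j))
        measurable_const).compl
    simp only [hbad, Set.ofPred_exists, Set.ofPred_and, Set.ofPred_forall]
    exact .iUnion fun i => .iUnion fun k => (MeasurableSet.const _).inter
      (.iInter fun j => .iInter fun _ => hc j k)
  have hsq : ∀ (i : Fin n) x y,
      (max (tspWeight h α (Function.update x i y) - tspWeight h α x) 0) ^ 2 ≤ M ^ 2 := by
    intro i x y
    refine pow_le_pow_left₀ (le_max_right _ _) (max_le ?_ ((hT0 x).trans (hTM x))) 2
    linarith [hT0 x, hTM (Function.update x i y)]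
  have hint : ∀ (i : Fin n) (x : Fin n → unitSquare), ∫ y, (max (tspWeight h α (Function.update x i y) - tspWeight h α x) 0) ^ 2 ∂μ
      ≤ M ^ 2 := by
    intro i x
    refine (integral_mono_of_nonneg (.of_forall fun y => sq_nonneg _) (integrable_const (M ^ 2))
      (.of_forall fun y => hsq i x y)).trans ?_
    simp
  have hmi : ∀ i : Fin n, Integrable (fun x : Fin n → unitSquare => ∫ y,
      (max (tspWeight h α (Function.update x i y) - tspWeight h α x) 0) ^ 2 ∂μ)
      (Measure.pi fun _ : Fin n => μ) := by
    intro i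
    have hu : Measurable fun p : (Fin n → unitSquare) × unitSquare =>
        (max (tspWeight h α (Function.update p.1 i p.2) - tspWeight h α p.1) 0) ^ 2 :=
      (((hTm.comp measurable_update').sub (hTm.comp measurable_fst)).max
        measurable_const).pow_const 2
    refine Integrable.of_bound hu.stronglyMeasurable.integral_prod_right.aestronglyMeasurable
      (M ^ 2) (.of_forall fun x => ?_)
    rw [Real.norm_eq_abs, abs_of_nonneg (integral_nonneg fun y => sq_nonneg _)]
    exact hint i x
  refine (variance_le_sum_integral_update μ hTm (M := M) fun x => by
    rw [abs_of_nonneg (hT0 x)]; exact hTM x).trans ?_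
  rw [← integral_finsetSum _ fun i _ => hmi i]
  -- Off `bad` the repair argument applies; on `bad` each of the n increases is bounded by the
  -- maximal weight `M`.
  have hle : ∀ x : Fin n → unitSquare, ∑ i, ∫ y,
      (max (tspWeight h α (Function.update x i y) - tspWeight h α x) 0) ^ 2 ∂μ ≤
      B + bad.indicator (fun _ => n * M ^ 2) x := by
    intro x
    by_cases hx : x ∈ bad
    · rw [Set.indicator_of_mem hx]
      have := Finset.sum_le_card_nsmul (Finset.univ : Finset (Fin n)) _ _ fun i _ => hint i x
      rw [Finset.card_univ, Fintype.card_fin, nsmul_eq_mul] at this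
      linarith
    · rw [Set.indicator_of_notMem hx, add_zero]
      refine sum_integral_update_le hα₀ hα₂ hc₁ hc₂ hh μ hm hn hq x ?_
      simpa [hbad] using hx
  have hI : Integrable (bad.indicator fun _ => n * M ^ 2) (Measure.pi fun _ : Fin n => μ) :=
    (integrable_const _).indicator hbadm
  refine (integral_mono (integrable_finsetSum _ fun i _ => hmi i)
    ((integrable_const B).add hI) hle).trans ?_
  simp only [Pi.add_apply]
  rw [integral_add (integrable_const B) hI, integral_const, integral_indicator_const _ hbadm]
  simp only [probReal_univ, one_mul, smul_eq_mul]
  gcongr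
  exact measure_exists_cell_avoided_le μ hp

end Variance

/-! ### Choice of the mesh and asymptotics -/

open Filter Topology in
theorem eventually_add_exp_le_rpow {β ε δ a C₁ C₂ : ℝ} (hβ : β < ε) (hε : 0 ≤ ε) (hδ : 0 < δ)
    (ha : 0 < a) :
    ∀ᶠ n : ℕ in atTop, C₁ * (n : ℝ) ^ β + C₂ * ((n : ℝ) ^ 5 * Real.exp (-(a * (n : ℝ) ^ δ))) ≤
      (n : ℝ) ^ ε := by
  have h1 : Tendsto (fun x : ℝ => C₁ * x ^ (-(ε - β))) atTop (𝓝 (C₁ * 0)) :=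
    (tendsto_rpow_neg_atTop (by linarith)).const_mul _
  -- x ^ 5 is written as a power of x ^ δ, so that the decay of y ^ s * exp (-a y) applies.
  have h2 : Tendsto (fun x : ℝ => C₂ * ((x ^ δ) ^ (5 / δ) * Real.exp (-a * x ^ δ))) atTop
      (𝓝 (C₂ * 0)) :=
    ((tendsto_rpow_mul_exp_neg_mul_atTop_nhds_zero (5 / δ) a ha).comp
      (tendsto_rpow_atTop hδ)).const_mul _
  rw [mul_zero] at h1 h2
  have h3 := (h1.eventually (gt_mem_nhds (by norm_num : (0 : ℝ) < 1 / 2))).and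
    ((h2.eventually (gt_mem_nhds (by norm_num : (0 : ℝ) < 1 / 2))).and (eventually_ge_atTop 1))
  filter_upwards [tendsto_natCast_atTop_atTop.eventually h3] with n ⟨e1, e2, e3⟩
  have hn : (0 : ℝ) < n := by linarith
  have hpow : (((n : ℝ) ^ δ) ^ (5 / δ)) = (n : ℝ) ^ 5 := by
    rw [← Real.rpow_mul hn.le, mul_div_cancel₀ _ hδ.ne']
    exact_mod_cast Real.rpow_natCast (n : ℝ) 5
  rw [hpow, neg_mul] at e2
  have hge : 1 ≤ (n : ℝ) ^ ε := Real.one_le_rpow e3 hε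
  have hsplit : (n : ℝ) ^ β = (n : ℝ) ^ ε * (n : ℝ) ^ (-(ε - β)) := by
    rw [← Real.rpow_add hn]; congr 1; ring
  have : C₁ * (n : ℝ) ^ β ≤ (n : ℝ) ^ ε * (1 / 2) := by
    rw [hsplit]
    calc _ = (n : ℝ) ^ ε * (C₁ * (n : ℝ) ^ (-(ε - β))) := by ring
      _ ≤ _ := by gcongr
  linarith

theorem measureReal_cell_bounds {f : unitSquare → ℝ} {ε₁ ε₂ : ℝ}
    (hε₁ : 0 < ε₁) (hf : ∀ x, ε₁ ≤ f x ∧ f x ≤ ε₂) {m k : ℕ} (hk : k < m ^ 2) :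
    ε₁ * (1 / m) ^ 2 ≤ ((((volume : Measure (EuclideanSpace ℝ (Fin 2))).comap
      (Subtype.val : unitSquare → EuclideanSpace ℝ (Fin 2))).withDensity
        fun x => ENNReal.ofReal (f x)).real {x | cellIndex m x = k}) ∧
    ((((volume : Measure (EuclideanSpace ℝ (Fin 2))).comap
      (Subtype.val : unitSquare → EuclideanSpace ℝ (Fin 2))).withDensity
        fun x => ENNReal.ofReal (f x)).real {x | cellIndex m x = k}) ≤ ε₂ * (1 / m) ^ 2 := by
  set ν := (volume : Measure (EuclideanSpace ℝ (Fin 2))).comap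
    (Subtype.val : unitSquare → EuclideanSpace ℝ (Fin 2)) with hν
  have hs : MeasurableSet {x | cellIndex m x = k} :=
    measurableSet_eq_fun (measurable_cellIndex m) measurable_const
  have hvol : ν {x | cellIndex m x = k} = ENNReal.ofReal ((1 / m) ^ 2) := comap_volume_cell hk
  have hε₂ : 0 < ε₂ := by
    have hne : (0 : EuclideanSpace ℝ (Fin 2)) ∈ unitSquare := fun i => by simp
    linarith [hf ⟨0, hne⟩]
  have hlow : ENNReal.ofReal (ε₁ * (1 / m) ^ 2) ≤
      (ν.withDensity fun x => ENNReal.ofReal (f x)) {x | cellIndex m x = k} := by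
    rw [withDensity_apply _ hs, ENNReal.ofReal_mul hε₁.le, ← hvol, ← setLIntegral_const]
    exact lintegral_mono fun x => ENNReal.ofReal_le_ofReal (hf x).1
  have hup : (ν.withDensity fun x => ENNReal.ofReal (f x)) {x | cellIndex m x = k} ≤
      ENNReal.ofReal (ε₂ * (1 / m) ^ 2) := by
    rw [withDensity_apply _ hs, ENNReal.ofReal_mul hε₂.le, ← hvol, ← setLIntegral_const]
    exact lintegral_mono fun x => ENNReal.ofReal_le_ofReal (hf x).2
  rw [measureReal_def]
  exact ⟨(ENNReal.ofReal_le_iff_le_toReal (hup.trans_lt ENNReal.ofReal_lt_top).ne).1 hlow,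
    ENNReal.toReal_le_of_le_ofReal (by positivity) hup⟩

/-- The bound of `variance_tspWeight_le` for a grid of mesh about `n ^ (-1 / 2 + δ)`. -/
theorem grid_bound_le {α δ ε₁ ε₂ K M : ℝ} (hα₀ : 0 < α) (hα₂ : α < 2) (hδ : 0 < δ)
    (hδ' : δ ≤ 1 / 4) (hε₁ : 0 < ε₁) (hε₂ : 0 < ε₂) (hK : 0 ≤ K) {n m : ℕ} (hn : 2 ≤ n)
    (hm : m = ⌈(n : ℝ) ^ (1 / 2 - δ)⌉₊) :
    K * (1 + n * (ε₂ * (1 / m) ^ 2)) * (n * (4 / m) ^ α + 4) +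
        n * m ^ 2 * Real.exp (-(ε₁ * (1 / m) ^ 2 * (n - 1 : ℕ))) * (n * (n * M) ^ 2) ≤
      K * (1 + ε₂) * 20 * (n : ℝ) ^ (1 - α / 2 + 4 * δ) +
        4 * M ^ 2 * ((n : ℝ) ^ 5 * Real.exp (-(ε₁ / 8 * (n : ℝ) ^ (2 * δ)))) := by
  have hn2 : (2 : ℝ) ≤ n := by exact_mod_cast hn
  have hn1 : (1 : ℝ) ≤ n := by linarith
  have hn0 : (0 : ℝ) < n := by linarith
  set u := (n : ℝ) ^ (1 / 2 - δ) with hu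
  set w := (n : ℝ) ^ (2 * δ) with hw
  have hu1 : 1 ≤ u := Real.one_le_rpow hn1 (by linarith)
  have hw1 : 1 ≤ w := Real.one_le_rpow hn1 (by linarith)
  have hu0 : 0 < u := by linarith
  -- With about `u ^ 2` cells, `w` is the order of the mean number of nodes per cell.
  have huw : u ^ 2 * w = n := by
    rw [hu, hw, ← Real.rpow_natCast, ← Real.rpow_mul hn0.le, ← Real.rpow_add hn0]
    conv_rhs => rw [← Real.rpow_one (n : ℝ)]
    congr 1; push_cast; ring
  have hum : u ≤ m := hm ▸ Nat.le_ceil u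
  have hmu : (m : ℝ) ≤ 2 * u := by
    have := Nat.ceil_lt_add_one hu0.le
    rw [← hm] at this
    linarith
  have hm0 : (0 : ℝ) < m := by linarith
  have hnm : n * (1 / m : ℝ) ^ 2 ≤ w := by
    rw [one_div_pow, mul_one_div, div_le_iff₀ (by positivity), ← huw, mul_comm]
    gcongr
  have hnm' : w / 4 ≤ n * (1 / m : ℝ) ^ 2 := by
    rw [one_div_pow, mul_one_div, le_div_iff₀ (by positivity), ← huw]
    calc w / 4 * (m : ℝ) ^ 2 ≤ w / 4 * (2 * u) ^ 2 := by gcongr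
      _ = u ^ 2 * w := by ring
  set v := (n : ℝ) ^ (1 - α / 2 + 2 * δ) with hv
  have hv1 : 1 ≤ v := Real.one_le_rpow hn1 (by linarith)
  have ht : n * (4 / m : ℝ) ^ α ≤ 16 * v := by
    have h4 : (4 : ℝ) ^ α ≤ 16 := by
      calc (4 : ℝ) ^ α ≤ 4 ^ (2 : ℝ) := Real.rpow_le_rpow_of_exponent_le (by norm_num) hα₂.le
        _ = 16 := by norm_num
    calc n * (4 / m : ℝ) ^ α ≤ n * (4 / u) ^ α := by gcongr
      _ = 4 ^ α * (n * (u ^ α)⁻¹) := by rw [Real.div_rpow (by norm_num) hu0.le]; ring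
      _ = 4 ^ α * (n : ℝ) ^ (1 - α / 2 + α * δ) := by
        rw [hu, ← Real.rpow_mul hn0.le, ← Real.rpow_neg hn0.le]
        nth_rewrite 1 [← Real.rpow_one (n : ℝ)]
        rw [← Real.rpow_add hn0]
        congr 2; ring
      _ ≤ 16 * v := by
        refine mul_le_mul h4 (Real.rpow_le_rpow_of_exponent_le hn1 ?_) (by positivity) (by norm_num)
        nlinarith
  have hvw : w * v = (n : ℝ) ^ (1 - α / 2 + 4 * δ) := by
    rw [hw, hv, ← Real.rpow_add hn0]; congr 1; ring
  refine add_le_add ?_ ?_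
  · rw [← hvw]
    calc K * (1 + n * (ε₂ * (1 / m) ^ 2)) * (n * (4 / m) ^ α + 4)
        = K * (1 + ε₂ * (n * (1 / m) ^ 2)) * (n * (4 / m) ^ α + 4) := by ring
      _ ≤ K * (w + ε₂ * w) * (16 * v + 4 * v) := by gcongr; linarith
      _ = K * (1 + ε₂) * 20 * (w * v) := by ring
  · have hexp : ε₁ / 8 * w ≤ ε₁ * (1 / m) ^ 2 * (n - 1 : ℕ) := by
      rw [Nat.cast_sub (by omega), Nat.cast_one]
      calc ε₁ / 8 * w = ε₁ / 2 * (w / 4) := by ring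
        _ ≤ ε₁ / 2 * (n * (1 / m : ℝ) ^ 2) := by gcongr
        _ = ε₁ * (1 / m : ℝ) ^ 2 * (n / 2) := by ring
        _ ≤ _ := by gcongr; linarith
    have hm4 : (m : ℝ) ^ 2 ≤ 4 * n := by
      calc (m : ℝ) ^ 2 ≤ (2 * u) ^ 2 := by gcongr
        _ = 4 * (u ^ 2 * 1) := by ring
        _ ≤ 4 * (u ^ 2 * w) := by gcongr
        _ = 4 * n := by rw [huw]
    calc _ ≤ n * (4 * n) * Real.exp (-(ε₁ / 8 * w)) * (n * (n * M) ^ 2) := by gcongr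
      _ = _ := by ring

theorem theorem2 (α : ℝ) (hα₀ : 0 < α) (hα₂ : α < 2)
    (ε : ℝ) (hε : (2 - α) * (1 + α) / (2 + α) < ε)
    (ε₁ ε₂ : ℝ) (hε₁ : 0 < ε₁) (hε₁₂ : ε₁ ≤ ε₂) :
    ∃ D : ℝ, 0 < D ∧
      ∀ c₁ c₂ : ℝ, 0 < c₁ → 0 < c₂ →
      ∃ n₀ : ℕ,
      ∀ (f : unitSquare → ℝ), Measurable f → (∀ x, ε₁ ≤ f x ∧ f x ≤ ε₂) →
      ∀ (h : unitSquare → unitSquare → ℝ),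
        Measurable (fun p : unitSquare × unitSquare => h p.1 p.2) →
        (∀ x y, h x y = h y x) →
        (∀ x y, c₁ * dist x y ≤ h x y ∧ h x y ≤ c₂ * dist x y) →
      ∀ (Ω : Type*) [MeasurableSpace Ω] (P : Measure Ω) [IsProbabilityMeasure P]
        (X : ℕ → Ω → unitSquare),
        (∀ i, Measurable (X i)) →
        iIndepFun X P →
        (∀ i, P.map (X i) =
          ((volume : Measure (EuclideanSpace ℝ (Fin 2))).comap
            (Subtype.val : unitSquare → EuclideanSpace ℝ (Fin 2))).withDensity
              (fun x => ENNReal.ofReal (f x))) →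
      ∀ n : ℕ, n₀ ≤ n →
        MemLp (TSP h α X n) 2 P ∧ variance (TSP h α X n) P ≤ D * (n : ℝ) ^ ε := by
  have hε₂ : 0 < ε₂ := hε₁.trans_le hε₁₂
  have hexp : 1 - α / 2 < ε := by
    refine lt_of_le_of_lt ?_ hε
    rw [le_div_iff₀ (by linarith)]
    nlinarith
  obtain ⟨δ, hδ, hδ4, hβ⟩ : ∃ δ : ℝ, 0 < δ ∧ δ ≤ 1 / 4 ∧ 1 - α / 2 + 4 * δ < ε := by
    refine ⟨min (1 / 4) ((ε - (1 - α / 2)) / 8), lt_min (by norm_num) (by linarith),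
      min_le_left _ _, ?_⟩
    linarith [min_le_right (1 / 4) ((ε - (1 - α / 2)) / 8)]
  -- The exponent obtained is strictly below `ε`, so `n₀` absorbs all constants and `D = 1` works.
  refine ⟨1, one_pos, fun c₁ c₂ hc₁ hc₂ => ?_⟩
  set K := 5776 * (c₂ ^ α) ^ 2 * (1 + 2 * (c₂ ^ α / c₁ ^ α)) with hK
  have hK0 : 0 ≤ K := by positivity
  obtain ⟨n₁, hn₁⟩ := Filter.eventually_atTop.1
    (eventually_add_exp_le_rpow (C₁ := K * (1 + ε₂) * 20) (C₂ := 4 * (c₂ ^ α * 4) ^ 2) hβ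
      (by linarith) (by positivity : 0 < 2 * δ) (by positivity : 0 < ε₁ / 8))
  refine ⟨max 3 n₁, fun f _ hf h hmeas _ hh Ω _ P _ X hX hind hlaw n hn => ?_⟩
  set μ := ((volume : Measure (EuclideanSpace ℝ (Fin 2))).comap
    (Subtype.val : unitSquare → EuclideanSpace ℝ (Fin 2))).withDensity
      (fun x => ENNReal.ofReal (f x)) with hμ
  have : IsProbabilityMeasure μ :=
    hlaw 0 ▸ Measure.isProbabilityMeasure_map (hX 0).aemeasurable
  have h0 : ∀ x y, 0 ≤ h x y := fun x y => (mul_nonneg hc₁.le dist_nonneg).trans (hh x y).1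
  have hXm : Measurable fun ω => fun i : Fin n => X i ω := measurable_pi_iff.2 fun i => hX i
  have hTm := measurable_tspWeight hmeas α n
  have hTSP : TSP h α X n = tspWeight h α ∘ fun ω => fun i : Fin n => X i ω := rfl
  constructor
  · rw [hTSP]
    refine MemLp.of_bound (hTm.comp hXm).aestronglyMeasurable (n * (c₂ ^ α * 4))
      (.of_forall fun ω => ?_)
    rw [Real.norm_eq_abs, Function.comp_apply, abs_of_nonneg (tspWeight_nonneg h0 _)]
    exact tspWeight_le_mul_card hα₀.le hα₂.le hc₂.le h0 (fun x y => (hh x y).2) _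
  · have hmap : P.map (fun ω => fun i : Fin n => X i ω) = Measure.pi fun _ : Fin n => μ := by
      have h1 := (iIndepFun_iff_map_fun_eq_pi_map (fun i : Fin n => (hX i).aemeasurable)).1
        (hind.precomp Fin.val_injective)
      rw [h1]
      congr 1
      funext i
      exact hlaw i
    rw [hTSP, ← variance_map hTm.aemeasurable hXm.aemeasurable, hmap, one_mul]
    set m := ⌈(n : ℝ) ^ (1 / 2 - δ)⌉₊ with hm
    have hn3 : 3 ≤ n := (le_max_left _ _).trans hn
    have hm0 : 0 < m := Nat.ceil_pos.2 (Real.rpow_pos_of_pos (by positivity) _)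
    exact (variance_tspWeight_le hα₀ hα₂ hc₁ hc₂ hmeas hh μ hm0 hn3
      (fun k hk => (measureReal_cell_bounds hε₁ hf hk).1)
      (fun k hk => (measureReal_cell_bounds hε₁ hf hk).2)).trans
      ((grid_bound_le hα₀ hα₂ hδ hδ4 hε₁ hε₂ hK0 (by omega) hm).trans
        (hn₁ n ((le_max_right _ _).trans hn)))
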